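/- Fix $d,l\in\mathbb{N}_0$, real numbers $0<m<L$ and $\rho\in(0,1)$. For real matrices $A,B,C,D$ of compatible sizes, let $\left[\begin{smallmatrix}A&B\\C&D\end{smallmatrix}\right]$ denote the input-output operator $w\mapsto z$ on the space of signals $\mathbb{N}_0\to\mathbb{R}^d$ given by $x_0=0$, $x_{k+1}=Ax_k+Bw_k$, $z_k=Cx_k+Dw_k$. Let $\mathcal{Q}$ be the set of all such operators (with $d$ inputs and outputs and arbitrary finite state dimension) that admit a description in which $A$ is Schur, i.e. all eigenvalues of $A$ have absolute value smaller than one. Let $\ell_2^d$ be the space of square-summable signals with $\langle x,y\rangle_2=\sum_{k\ge 0}x_k^Ty_k$. A linear operator $G$ on signals is called strictly negative real (SNR) if there is $\varepsilon>0$ such that $Gw\in\ell_2^d$ and $\langle Gw,w\rangle_2\le-\varepsilon\|w\|_2^2$ for all $w\in\ell_2^d$. Let $\mathbf{\Lambda}_\rho$ be the set of all tuples $\Lambda=(\Lambda_l,\dots,\Lambda_1,\Lambda_0)$ of real $d\times d$ matrices such that the off-diagonal entries of $\Lambda_0$ and all entries of $\Lambda_1,\dots,\Lambda_l$ are nonpositive,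 and such that, elementwise, $\big(\sum_{i=0}^l\Lambda_i\rho^i\big)e\ge 0$ and $e^T\big(\sum_{i=0}^l\Lambda_i\rho^{-i}\big)\ge 0$ for the all-ones vector $e$. Let $\Pi(\Lambda)$ be the finite-impulse-response filter $z_k=\sum_{i=0}^{\min(k,l)}\Lambda_iw_{k-i}$, realized with the state $(w_{k-l},\dots,w_{k-1})$. With $\sigma:=L/m-1$ put $$T_1=\left[\begin{array}{c|c}0&-\rho^{-1}I_d\\\hline \sigma I_d&-I_d\end{array}\right],\qquad T_2=(L-m)I_d,\qquad T_3=\left[\begin{array}{cc|c}0&0&-\rho^{-1}I_d\\ \rho^{-1}I_d&0&\rho^{-1}I_d\\\hline 0&I_d&0\end{array}\right].$$ Let $\mathbf{\Lambda}\subset\mathbf{\Lambda}_\rho$ be convex and contain the trivial multiplier $(0,\dots,0,I)$. Then: (a) $\Pi(\Lambda)(T_1+T_2QT_3)$ is SNR for some $\Lambda\in\mathbf{\Lambda}$ and $Q\in\mathcal{Q}$ if and only if $\Pi(\Lambda)T_1+ZT_3$ is SNR for some $\Lambda\in\mathbf{\Lambda}$ and $Z\in\mathcal{Q}$. (b) For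 all $\Lambda\in\mathbf{\Lambda}$ and $Q\in\mathcal{Q}$, the operator $Z:=\Pi(\Lambda)T_2Q$ belongs to $\mathcal{Q}$ and satisfies $\Pi(\Lambda)(T_1+T_2QT_3)=\Pi(\Lambda)T_1+ZT_3$. (c) The set of all pairs $(\Lambda,Z)\in\mathbf{\Lambda}\times\mathcal{Q}$ for which $\Pi(\Lambda)T_1+ZT_3$ is SNR is convex. -/

import Mathlib

open scoped Matrix

noncomputable section

/-- The vector space of all signals `ℕ → ℝ^d`. -/
abbrev Signal (d : ℕ) : Type := ℕ → EuclideanSpace ℝ (Fin d)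

/-- The space `l₂^d` of square-summable signals, with `⟪x, y⟫ = ∑ₖ xₖᵀ yₖ`. -/
abbrev L2Signal (d : ℕ) : Type := lp (fun _ : ℕ => EuclideanSpace ℝ (Fin d)) 2

/-- A state-space description `x_{k+1} = A x_k + B w_k`, `z_k = C x_k + D w_k` with `d` inputs and
`d` outputs; the coordinates of the state are indexed by `ι`. -/
structure StateSpace (ι : Type) (d : ℕ) where
  A : Matrix ι ι ℝ
  B : Matrix ι (Fin d) ℝ
  C : Matrix (Fin d) ι ℝ
  D : Matrix (Fin d) (Fin d) ℝ

namespace StateSpace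

variable {ι : Type} [Fintype ι] {d : ℕ}

/-- The state response to the input `w` for the initial condition `x₀ = 0`. -/
def state (G : StateSpace ι d) (w : Signal d) : ℕ → ι → ℝ
  | 0 => 0
  | k + 1 => G.A *ᵥ G.state w k + G.B *ᵥ (w k).ofLp

theorem state_add (G : StateSpace ι d) (v w : Signal d) (k : ℕ) :
    G.state (v + w) k = G.state v k + G.state w k := by
  induction k with
  | zero => simp [state]
  | succ k ih => simp only [state, ih, Pi.add_apply, WithLp.ofLp_add, Matrix.mulVec_add]; abel

theorem state_smul (G : StateSpace ι d) (c : ℝ) (w : Signal d) (k : ℕ) :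
    G.state (c • w) k = c • G.state w k := by
  induction k with
  | zero => simp [state]
  | succ k ih =>
    simp only [state, ih, Pi.smul_apply, WithLp.ofLp_smul, Matrix.mulVec_smul, smul_add]

/-- The input-output operator of the system, for the initial condition `x₀ = 0`. -/
def op (G : StateSpace ι d) : Signal d →ₗ[ℝ] Signal d where
  toFun w k := WithLp.toLp 2 (G.C *ᵥ G.state w k + G.D *ᵥ (w k).ofLp)
  map_add' v w := by
    funext k
    simp only [state_add, Pi.add_apply, WithLp.ofLp_add, Matrix.mulVec_add, ← WithLp.toLp_add]
    congr 1
    abel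
  map_smul' c w := by
    funext k
    simp only [state_smul, Pi.smul_apply, WithLp.ofLp_smul, Matrix.mulVec_smul, ← smul_add,
      WithLp.toLp_smul, RingHom.id_apply]

end StateSpace

/-- A real square matrix is Schur if all its complex eigenvalues have absolute value `< 1`. -/
def IsSchur {ι : Type} [Fintype ι] [DecidableEq ι] (A : Matrix ι ι ℝ) : Prop :=
  ∀ μ ∈ spectrum ℂ (A.map (algebraMap ℝ ℂ)), ‖μ‖ < 1

/-- The set of all stable systems with `d` inputs and outputs, of arbitrary finite state dimension,
viewed as input-output operators. -/
def stableSystems (d : ℕ) : Set (Signal d →ₗ[ℝ] Signal d) :=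
  {Q | ∃ (n : ℕ) (G : StateSpace (Fin n) d), IsSchur G.A ∧ G.op = Q}

/-- `G` is strictly negative real: there is `ε > 0` such that, for all `w` in `l₂^d`, the response
`G w` is in `l₂^d` and `⟪G w, w⟫ ≤ -ε ‖w‖²`. -/
def IsStrictlyNegativeReal {d : ℕ} (G : Signal d →ₗ[ℝ] Signal d) : Prop :=
  ∃ ε : ℝ, 0 < ε ∧ ∀ w : L2Signal d, ∃ z : L2Signal d,
    (z : Signal d) = G (w : Signal d) ∧ inner ℝ z w ≤ -ε * ‖w‖ ^ 2

/-- The set of multiplier parameters. The tuple `(Λ_l, …, Λ_1, Λ_0)` is encoded as `i ↦ Λ_i`. -/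
def multiplierSet (d l : ℕ) (ρ : ℝ) : Set (Fin (l + 1) → Matrix (Fin d) (Fin d) ℝ) :=
  {Λ | (∀ a b, (Λ 0 - Matrix.diagonal (Λ 0).diag) a b ≤ 0) ∧
    (∀ i, i ≠ 0 → ∀ a b, Λ i a b ≤ 0) ∧
    (∀ a, 0 ≤ ((∑ i : Fin (l + 1), ρ ^ (i : ℕ) • Λ i) *ᵥ 1) a) ∧
    (∀ b, 0 ≤ (1 ᵥ* (∑ i : Fin (l + 1), (ρ⁻¹) ^ (i : ℕ) • Λ i)) b)}

/-- The trivial multiplier parameter `(0, …, 0, I)`, that is, `Λ_0 = I` and `Λ_i = 0` for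
`i ≠ 0`. -/
def trivialMultiplier (d l : ℕ) : Fin (l + 1) → Matrix (Fin d) (Fin d) ℝ :=
  Pi.single 0 1

/-- The finite-impulse-response filter `Π(Λ)`. The state consists of `l` blocks of size `d`; its
block `j` (counted from `0`) is multiplied by `Λ_{l-j}` in the output, and the state matrix shifts
the blocks upwards. -/
def firFilter {d l : ℕ} (Λ : Fin (l + 1) → Matrix (Fin d) (Fin d) ℝ) :
    StateSpace (Fin l × Fin d) d where
  A := Matrix.of fun p q => if (q.1 : ℕ) = (p.1 : ℕ) + 1 ∧ p.2 = q.2 then 1 else 0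
  B := Matrix.of fun p b => if (p.1 : ℕ) + 1 = l ∧ p.2 = b then 1 else 0
  C := Matrix.of fun a q => Λ ⟨l - (q.1 : ℕ), by omega⟩ a q.2
  D := Λ 0

/-- The system `T₁`, with `σ = L / m - 1`. -/
def youlaT1 (d : ℕ) (m L ρ : ℝ) : StateSpace (Fin d) d where
  A := 0
  B := -ρ⁻¹ • 1
  C := (L * m⁻¹ - 1) • 1
  D := -1

/-- The static system `T₂ = L I - m I`. -/
def youlaT2 (d : ℕ) (m L : ℝ) : StateSpace (Fin 0) d where
  A := 0
  B := 0
  C := 0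
  D := L • 1 - m • 1

/-- The system `T₃`. -/
def youlaT3 (d : ℕ) (ρ : ℝ) : StateSpace (Fin d ⊕ Fin d) d where
  A := Matrix.fromBlocks 0 0 (ρ⁻¹ • 1) 0
  B := Matrix.fromRows (-ρ⁻¹ • 1) (ρ⁻¹ • 1)
  C := Matrix.fromCols 0 1
  D := 0

end

/-! Part (b) is distributivity together with closure of the stable systems under composition. Part
(c) holds because `Π(Λ)T₁ + ZT₃` is linear in `(Λ, Z)` and strict negative realness survives convex
combinations.

The content is the converse in (a): recovering `Q` from `Z = Π(Λ)T₂Q` needs a stable inverse of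
`Π(Λ)`, which a general `Λ` lacks. Hence `(Λ, Z)` is moved slightly towards `(trivial multiplier,
0)`, whose operator is `T₁`. As `T₁` is bounded on `l₂`, a small step keeps strict negative realness
(`IsStrictlyNegativeReal.exists_perturbation`). It also makes the `ρ⁻¹`-weighted column sums
strictly positive, so the symbol is strictly column diagonally dominant on the closed unit disc in
`z⁻¹` (`det_firSymbol_ne_zero`), and the inverse filter is stable. -/

namespace Matrix

variable {n : Type*} [Fintype n] [DecidableEq n]

theorem mem_spectrum_iff_exists_mulVec_eq_smul {K : Type*} [Field K] (A : Matrix n n K) (μ : K) :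
    μ ∈ spectrum K A ↔ ∃ v, v ≠ 0 ∧ A *ᵥ v = μ • v := by
  rw [spectrum.mem_iff, Matrix.isUnit_iff_isUnit_det, isUnit_iff_ne_zero, not_not,
    ← Matrix.exists_mulVec_eq_zero_iff]
  refine exists_congr fun v => and_congr_right fun _ => ?_
  rw [Algebra.algebraMap_eq_smul_one, Matrix.sub_mulVec, Matrix.smul_mulVec, Matrix.one_mulVec,
    sub_eq_zero, eq_comm]

end Matrix

/-! ### Schur matrices. -/

namespace IsSchur

variable {ι κ : Type} [Fintype ι] [DecidableEq ι] [Fintype κ] [DecidableEq κ]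

theorem reindex {A : Matrix ι ι ℝ} (hA : IsSchur A) (e : ι ≃ κ) :
    IsSchur (Matrix.reindex e e A) := by
  intro μ hμ
  obtain ⟨v, hv, h⟩ := (Matrix.mem_spectrum_iff_exists_mulVec_eq_smul _ _).1 hμ
  refine hA μ ((Matrix.mem_spectrum_iff_exists_mulVec_eq_smul _ _).2 ⟨v ∘ e, ?_, ?_⟩)
  · intro h0
    apply hv
    funext i
    simpa using congrFun h0 (e.symm i)
  · funext i
    have := congrFun h (e i)
    rw [Matrix.reindex_apply, ← Matrix.submatrix_map, Matrix.submatrix_mulVec_equiv] at this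
    simpa using this

/-- An eigenvector has either a nonzero lower part, which is then an eigenvector of `D`, or a zero
lower part, and then its upper part is an eigenvector of `A`. -/
theorem fromBlocks_zero₂₁ {A : Matrix ι ι ℝ} {D : Matrix κ κ ℝ} (hA : IsSchur A) (hD : IsSchur D)
    (B : Matrix ι κ ℝ) : IsSchur (Matrix.fromBlocks A B 0 D) := by
  intro μ hμ
  obtain ⟨v, hv, h⟩ := (Matrix.mem_spectrum_iff_exists_mulVec_eq_smul _ _).1 hμ
  rw [Matrix.fromBlocks_map, Matrix.fromBlocks_mulVec] at h
  by_cases h2 : v ∘ Sum.inr = 0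
  · refine hA μ ((Matrix.mem_spectrum_iff_exists_mulVec_eq_smul _ _).2 ⟨v ∘ Sum.inl, ?_, ?_⟩)
    · intro h1
      apply hv
      funext i
      cases i with
      | inl i => exact congrFun h1 i
      | inr i => exact congrFun h2 i
    · funext i
      simpa [h2] using congrFun h (Sum.inl i)
  · refine hD μ ((Matrix.mem_spectrum_iff_exists_mulVec_eq_smul _ _).2 ⟨v ∘ Sum.inr, h2, ?_⟩)
    funext i
    simpa [Matrix.map_zero] using congrFun h (Sum.inr i)

end IsSchur

/-! ### Interconnections and inverses of state-space systems. -/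

namespace StateSpace

variable {ι κ : Type} [Fintype ι] [Fintype κ] {d : ℕ}

theorem op_apply (G : StateSpace ι d) (w : Signal d) (k : ℕ) :
    G.op w k = WithLp.toLp 2 (G.C *ᵥ G.state w k + G.D *ᵥ (w k).ofLp) := rfl

/-- A relabelling of the state coordinates. -/
def reindex (G : StateSpace ι d) (e : ι ≃ κ) : StateSpace κ d where
  A := Matrix.reindex e e G.A
  B := G.B.submatrix e.symm id
  C := G.C.submatrix id e.symm
  D := G.D

theorem state_reindex (G : StateSpace ι d) (e : ι ≃ κ) (w : Signal d) (k : ℕ) :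
    (G.reindex e).state w k = G.state w k ∘ e.symm := by
  induction k with
  | zero => rfl
  | succ k ih =>
    simp only [state, ih]
    simp only [reindex, Matrix.reindex_apply, Matrix.submatrix_mulVec_equiv, Function.comp_assoc,
      Equiv.symm_symm, Equiv.symm_comp_self, Function.comp_id]
    rfl

theorem op_reindex (G : StateSpace ι d) (e : ι ≃ κ) : (G.reindex e).op = G.op := by
  ext w k : 2
  simp only [op_apply, state_reindex]
  simp only [reindex, Matrix.submatrix_mulVec_equiv, Function.comp_assoc, Equiv.symm_symm,
    Equiv.symm_comp_self, Function.comp_id]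

/-- The parallel connection of two systems. -/
def parallel (G : StateSpace ι d) (H : StateSpace κ d) : StateSpace (ι ⊕ κ) d where
  A := Matrix.fromBlocks G.A 0 0 H.A
  B := Matrix.fromRows G.B H.B
  C := Matrix.fromCols G.C H.C
  D := G.D + H.D

theorem state_parallel (G : StateSpace ι d) (H : StateSpace κ d) (w : Signal d) (k : ℕ) :
    (G.parallel H).state w k = Sum.elim (G.state w k) (H.state w k) := by
  induction k with
  | zero => funext i; cases i <;> rfl
  | succ k ih =>
    simp only [state, ih]
    simp [parallel, Matrix.fromBlocks_mulVec, Matrix.fromRows_mulVec, Sum.elim_add_add]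

theorem op_parallel (G : StateSpace ι d) (H : StateSpace κ d) :
    (G.parallel H).op = G.op + H.op := by
  ext w k : 2
  simp only [op_apply, state_parallel, LinearMap.add_apply, Pi.add_apply, ← WithLp.toLp_add]
  simp only [parallel, Matrix.fromCols_mulVec_sumElim, Matrix.add_mulVec]
  congr 1
  abel

/-- The series connection in which `G` is driven by the output of `H`. -/
def series (G : StateSpace ι d) (H : StateSpace κ d) : StateSpace (ι ⊕ κ) d where
  A := Matrix.fromBlocks G.A (G.B * H.C) 0 H.A
  B := Matrix.fromRows (G.B * H.D) H.B
  C := Matrix.fromCols G.C (G.D * H.C)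
  D := G.D * H.D

theorem state_series (G : StateSpace ι d) (H : StateSpace κ d) (w : Signal d) (k : ℕ) :
    (G.series H).state w k = Sum.elim (G.state (H.op w) k) (H.state w k) := by
  induction k with
  | zero => funext i; cases i <;> rfl
  | succ k ih =>
    simp only [state, ih]
    simp only [series, Matrix.fromBlocks_mulVec, Matrix.fromRows_mulVec, ← Sum.elim_add_add,
      op_apply, Matrix.mulVec_add, Matrix.mulVec_mulVec, Sum.elim_comp_inl, Sum.elim_comp_inr,
      Matrix.zero_mulVec, zero_add, add_assoc]

theorem op_series (G : StateSpace ι d) (H : StateSpace κ d) :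
    (G.series H).op = G.op ∘ₗ H.op := by
  ext w k : 2
  simp only [LinearMap.comp_apply]
  rw [op_apply, op_apply G, state_series]
  simp only [series, Matrix.fromCols_mulVec_sumElim, op_apply, Matrix.mulVec_add,
    Matrix.mulVec_mulVec, add_assoc]

/-- The system whose output is the output of `G` scaled by `c`. -/
def scale (c : ℝ) (G : StateSpace ι d) : StateSpace ι d where
  A := G.A
  B := G.B
  C := c • G.C
  D := c • G.D

theorem state_scale (c : ℝ) (G : StateSpace ι d) (w : Signal d) (k : ℕ) :
    (G.scale c).state w k = G.state w k := by
  induction k with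
  | zero => rfl
  | succ k ih => simp only [state, ih]; rfl

theorem op_scale (c : ℝ) (G : StateSpace ι d) : (G.scale c).op = c • G.op := by
  ext w k : 2
  simp only [op_apply, state_scale, LinearMap.smul_apply, Pi.smul_apply, ← WithLp.toLp_smul]
  simp only [scale, Matrix.smul_mulVec, smul_add]

/-- The inverse system, for an invertible feedthrough matrix. -/
noncomputable def inverse (G : StateSpace ι d) : StateSpace ι d where
  A := G.A - G.B * G.D⁻¹ * G.C
  B := G.B * G.D⁻¹
  C := -(G.D⁻¹ * G.C)
  D := G.D⁻¹

/-- The inverse system outputs `u = D⁻¹(w - Cx)`; substituting, its update is `x ↦ Ax + Bu`, so both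
systems follow the same state trajectory. -/
theorem state_op_inverse (G : StateSpace ι d) (w : Signal d) (k : ℕ) :
    G.state (G.inverse.op w) k = G.inverse.state w k := by
  induction k with
  | zero => rfl
  | succ k ih =>
    simp only [state, ih, op_apply]
    simp only [inverse, Matrix.mulVec_add, Matrix.sub_mulVec, Matrix.neg_mulVec, Matrix.mulVec_neg,
      Matrix.mulVec_mulVec, Matrix.mul_assoc]
    abel

theorem op_comp_inverse (G : StateSpace ι d) (hD : IsUnit G.D.det) :
    G.op ∘ₗ G.inverse.op = LinearMap.id := by
  ext w k : 2
  rw [LinearMap.comp_apply, op_apply, state_op_inverse, op_apply]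
  simp only [inverse, Matrix.mulVec_add, Matrix.neg_mulVec, Matrix.mulVec_neg,
      Matrix.mulVec_mulVec, ← Matrix.mul_assoc, Matrix.mul_nonsing_inv _ hD, Matrix.one_mul,
      Matrix.one_mulVec, add_neg_cancel_left, WithLp.toLp_ofLp, LinearMap.id_apply]

theorem op_mem_stableSystems [DecidableEq ι] (G : StateSpace ι d) (hG : IsSchur G.A) :
    G.op ∈ stableSystems d :=
  ⟨Fintype.card ι, G.reindex (Fintype.equivFin ι), hG.reindex _, G.op_reindex _⟩

end StateSpace

/-! ### Closure properties of the stable systems. -/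

section stableSystems

variable {d : ℕ} {P Q : Signal d →ₗ[ℝ] Signal d}

theorem add_mem_stableSystems (hP : P ∈ stableSystems d) (hQ : Q ∈ stableSystems d) :
    P + Q ∈ stableSystems d := by
  obtain ⟨_, G, hG, rfl⟩ := hP
  obtain ⟨_, H, hH, rfl⟩ := hQ
  rw [← StateSpace.op_parallel]
  exact StateSpace.op_mem_stableSystems _ (hG.fromBlocks_zero₂₁ hH 0)

theorem comp_mem_stableSystems (hP : P ∈ stableSystems d) (hQ : Q ∈ stableSystems d) :
    P ∘ₗ Q ∈ stableSystems d := by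
  obtain ⟨_, G, hG, rfl⟩ := hP
  obtain ⟨_, H, hH, rfl⟩ := hQ
  rw [← StateSpace.op_series]
  exact StateSpace.op_mem_stableSystems _ (hG.fromBlocks_zero₂₁ hH _)

theorem smul_mem_stableSystems (c : ℝ) (hP : P ∈ stableSystems d) :
    c • P ∈ stableSystems d := by
  obtain ⟨n, G, hG, rfl⟩ := hP
  exact ⟨n, G.scale c, hG, G.op_scale c⟩

theorem convex_stableSystems : Convex ℝ (stableSystems d) :=
  fun _ hP _ hQ a b _ _ _ =>
    add_mem_stableSystems (smul_mem_stableSystems a hP) (smul_mem_stableSystems b hQ)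

end stableSystems

/-! ### The filter `Π(Λ)`: linearity in `Λ`, symbol and stable inversion. -/

section firFilter

variable {d l : ℕ}

/-- `Λ` enters only the output matrices `C` and `D`; this makes `Λ ↦ Π(Λ)` linear. -/
theorem state_firFilter_congr (Λ Λ' : Fin (l + 1) → Matrix (Fin d) (Fin d) ℝ) (w : Signal d)
    (k : ℕ) : (firFilter Λ).state w k = (firFilter Λ').state w k := by
  induction k with
  | zero => rfl
  | succ k ih => simp only [StateSpace.state, ih]; rfl

theorem op_firFilter_add (Λ Λ' : Fin (l + 1) → Matrix (Fin d) (Fin d) ℝ) :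
    (firFilter (Λ + Λ')).op = (firFilter Λ).op + (firFilter Λ').op := by
  ext w k : 2
  simp only [StateSpace.op_apply, LinearMap.add_apply, Pi.add_apply, ← WithLp.toLp_add,
    state_firFilter_congr Λ (Λ + Λ'), state_firFilter_congr Λ' (Λ + Λ')]
  have hC : (firFilter (Λ + Λ')).C = (firFilter Λ).C + (firFilter Λ').C := rfl
  have hD : (firFilter (Λ + Λ')).D = (firFilter Λ).D + (firFilter Λ').D := rfl
  rw [hC, hD, Matrix.add_mulVec, Matrix.add_mulVec, add_add_add_comm]

theorem op_firFilter_smul (c : ℝ) (Λ : Fin (l + 1) → Matrix (Fin d) (Fin d) ℝ) :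
    (firFilter (c • Λ)).op = c • (firFilter Λ).op := by
  ext w k : 2
  simp only [StateSpace.op_apply, LinearMap.smul_apply, Pi.smul_apply, ← WithLp.toLp_smul,
    state_firFilter_congr Λ (c • Λ)]
  have hC : (firFilter (c • Λ)).C = c • (firFilter Λ).C := rfl
  have hD : (firFilter (c • Λ)).D = c • (firFilter Λ).D := rfl
  rw [hC, hD, Matrix.smul_mulVec, Matrix.smul_mulVec, smul_add]

theorem op_firFilter_trivialMultiplier :
    (firFilter (trivialMultiplier d l)).op = LinearMap.id := by
  have hC : (firFilter (trivialMultiplier d l)).C = 0 := by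
    ext a q
    have : (⟨l - (q.1 : ℕ), by omega⟩ : Fin (l + 1)) ≠ 0 := by
      have := q.1.2
      simp only [ne_eq, Fin.ext_iff, Fin.val_zero]
      omega
    simp [firFilter, trivialMultiplier, this]
  have hD : (firFilter (trivialMultiplier d l)).D = 1 := by simp [firFilter, trivialMultiplier]
  ext w k : 2
  simp [StateSpace.op_apply, hC, hD]

/-- The transfer function of the filter `Π(Λ)`, as a polynomial in `z⁻¹`, evaluated at `z⁻¹ = s`. -/
noncomputable def firSymbol (Λ : Fin (l + 1) → Matrix (Fin d) (Fin d) ℝ) (s : ℂ) :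
    Matrix (Fin d) (Fin d) ℂ :=
  ∑ i : Fin (l + 1), s ^ (i : ℕ) • (Λ i).map (algebraMap ℝ ℂ)

theorem firSymbol_apply (Λ : Fin (l + 1) → Matrix (Fin d) (Fin d) ℝ) (s : ℂ) (a b : Fin d) :
    firSymbol Λ s a b = ∑ i : Fin (l + 1), s ^ (i : ℕ) * (Λ i a b : ℂ) := by
  simp [firSymbol, Matrix.sum_apply]

theorem firSymbol_zero (Λ : Fin (l + 1) → Matrix (Fin d) (Fin d) ℝ) :
    firSymbol Λ 0 = (Λ 0).map (algebraMap ℝ ℂ) := by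
  simp [firSymbol, Fin.sum_univ_succ]

/-- The equation is a shift recursion: `μ` times a block is the next block, and `μ` times the last
block is `u`. The blocks are therefore geometric in `μ⁻¹`. With `u = 0` this gives stability of the
filter, with a state feedback `u` that of its inverse. -/
theorem eq_of_firFilter_mulVec_eq_smul (Λ : Fin (l + 1) → Matrix (Fin d) (Fin d) ℝ) {μ : ℂ}
    (hμ : μ ≠ 0) (v : Fin l × Fin d → ℂ) (u : Fin d → ℂ)
    (h : (firFilter Λ).A.map (algebraMap ℝ ℂ) *ᵥ v + (firFilter Λ).B.map (algebraMap ℝ ℂ) *ᵥ u =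
      μ • v) (j : Fin l) (a : Fin d) : v (j, a) = μ⁻¹ ^ (l - (j : ℕ)) * u a := by
  have key : ∀ j : Fin l, μ * v (j, a) =
      if hj : (j : ℕ) + 1 < l then v (⟨j + 1, hj⟩, a) else u a := by
    intro j
    have h1 := congrFun h (j, a)
    simp only [Pi.add_apply, Matrix.mulVec, dotProduct, firFilter, Matrix.map_apply, Matrix.of_apply,
      Pi.smul_apply, smul_eq_mul, apply_ite (algebraMap ℝ ℂ), map_one, map_zero, ite_mul, one_mul, zero_mul] at h1
    rw [← h1]
    split_ifs with hj
    · rw [Finset.sum_eq_single (⟨j + 1, hj⟩, a), if_pos ⟨rfl, rfl⟩, Finset.sum_eq_zero, add_zero]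
      · intro b _
        rw [if_neg]
        omega
      · rintro ⟨q, b⟩ _ hq
        rw [if_neg]
        rintro ⟨h2, h3⟩
        exact hq (Prod.ext (Fin.ext h2) h3.symm)
      · simp
    · rw [Finset.sum_eq_zero, zero_add, Finset.sum_eq_single a, if_pos ⟨by omega, rfl⟩]
      · intro b _ hb
        rw [if_neg]
        rintro ⟨-, h3⟩
        exact hb h3.symm
      · simp
      · rintro ⟨q, b⟩ _
        have := q.2
        rw [if_neg]
        simp only
        omega
  -- Induction on the distance `l - j` to the block fed by the input.
  have step : ∀ (n : ℕ) (j : Fin l), l - (j : ℕ) = n + 1 → v (j, a) = μ⁻¹ ^ (n + 1) * u a := by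
    intro n
    induction n with
    | zero =>
      intro j hj
      have := key j
      rw [dif_neg (by omega)] at this
      rw [zero_add, pow_one, eq_inv_mul_iff_mul_eq₀ hμ, this]
    | succ n ih =>
      intro j hj
      have := key j
      rw [dif_pos (by omega), ih ⟨j + 1, by omega⟩ (by rw [Nat.sub_add_eq, hj, Nat.add_sub_cancel])]
        at this
      rw [pow_succ', mul_assoc, eq_inv_mul_iff_mul_eq₀ hμ, this]
  obtain ⟨n, hn⟩ : ∃ n, l - (j : ℕ) = n + 1 := ⟨l - j - 1, by omega⟩
  rw [hn, step n j hn]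

theorem isSchur_firFilter (Λ : Fin (l + 1) → Matrix (Fin d) (Fin d) ℝ) :
    IsSchur (firFilter Λ).A := by
  intro μ hμ
  obtain ⟨v, hv, h⟩ := (Matrix.mem_spectrum_iff_exists_mulVec_eq_smul _ _).1 hμ
  by_contra! h1
  have h0 : μ ≠ 0 := norm_pos_iff.1 (by linarith)
  refine hv (funext fun p => ?_)
  rw [← Prod.mk.eta (p := p), eq_of_firFilter_mulVec_eq_smul Λ h0 v 0 (by simpa using h)]
  simp

theorem firFilter_mulVec_add_mulVec (Λ : Fin (l + 1) → Matrix (Fin d) (Fin d) ℝ) (s : ℂ)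
    (u : Fin d → ℂ) :
    (firFilter Λ).C.map (algebraMap ℝ ℂ) *ᵥ (fun p => s ^ (l - (p.1 : ℕ)) * u p.2) +
      (firFilter Λ).D.map (algebraMap ℝ ℂ) *ᵥ u = firSymbol Λ s *ᵥ u := by
  funext a
  -- Block `j` meets `Λ_{l-j}`, so the sum over blocks runs through `Λ_l, …, Λ_1` in reverse order.
  have h : ∀ j : Fin l, (Fin.rev j).succ = (⟨l - (j : ℕ), by omega⟩ : Fin (l + 1)) := by
    intro j
    ext
    simp only [Fin.val_succ, Fin.val_rev]
    omega
  simp only [Pi.add_apply, Matrix.mulVec, dotProduct, firSymbol_apply, Finset.sum_mul]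
  rw [Finset.sum_comm, Fin.sum_univ_succ, add_comm, Fintype.sum_prod_type,
    ← Equiv.sum_comp Fin.revPerm (fun i : Fin l => ∑ b, s ^ (i.succ : ℕ) * (Λ i.succ a b : ℂ) * u b)]
  simp only [Fin.revPerm_apply, h, firFilter, Matrix.map_apply, Matrix.of_apply, Fin.val_zero,
    pow_zero, one_mul, Complex.coe_algebraMap]
  congr 1
  refine Finset.sum_congr rfl fun j _ => Finset.sum_congr rfl fun b _ => ?_
  ring

/-- An eigenvector `v` for `‖μ‖ ≥ 1` yields `u = -D⁻¹Cv` with `Av + Bu = μv` and `Cv + Du = 0`. The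
first equation makes `v` geometric, the second then says that the symbol at `μ⁻¹` kills `u`; so `u =
0` and `v = 0`. -/
theorem isSchur_inverse_firFilter (Λ : Fin (l + 1) → Matrix (Fin d) (Fin d) ℝ)
    (h : ∀ s : ℂ, ‖s‖ ≤ 1 → (firSymbol Λ s).det ≠ 0) (hD : IsUnit (firFilter Λ).D.det) :
    IsSchur (firFilter Λ).inverse.A := by
  intro μ hμ
  obtain ⟨v, hv, hAv⟩ := (Matrix.mem_spectrum_iff_exists_mulVec_eq_smul _ _).1 hμ
  by_contra! h1
  have h0 : μ ≠ 0 := norm_pos_iff.1 (by linarith)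
  set u : Fin d → ℂ := -(((firFilter Λ).D⁻¹ * (firFilter Λ).C).map (algebraMap ℝ ℂ) *ᵥ v) with hu
  have hv' := eq_of_firFilter_mulVec_eq_smul Λ h0 v u (by
    rw [← hAv, hu, Matrix.mulVec_neg, Matrix.mulVec_mulVec, ← Matrix.map_mul, ← Matrix.mul_assoc,
      ← sub_eq_add_neg, ← Matrix.sub_mulVec]
    congr 1
    exact (Matrix.map_sub _ (map_sub _) _ _).symm)
  have hvu : v = fun p : Fin l × Fin d => μ⁻¹ ^ (l - (p.1 : ℕ)) * u p.2 :=
    funext fun p => hv' p.1 p.2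
  have hsym : firSymbol Λ μ⁻¹ *ᵥ u = 0 := by
    rw [← firFilter_mulVec_add_mulVec, ← hvu, hu, Matrix.mulVec_neg, Matrix.mulVec_mulVec,
      ← Matrix.map_mul, ← Matrix.mul_assoc, Matrix.mul_nonsing_inv _ hD, Matrix.one_mul, add_neg_cancel]
  have hu0 : u = 0 := by
    by_contra hne
    refine h μ⁻¹ ?_ (Matrix.exists_mulVec_eq_zero_iff.1 ⟨u, hne, hsym⟩)
    rw [norm_inv]
    exact inv_le_one_of_one_le₀ h1
  apply hv
  rw [hvu, hu0]
  simp only [Pi.zero_apply, mul_zero]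
  rfl

/-- Since `‖s‖ ≤ 1 ≤ ρ⁻¹`, replacing `s` by `ρ⁻¹` only makes the nonpositive coefficients weigh
more. The positive column sums at `ρ⁻¹` thus give strict column diagonal dominance at `s`. -/
theorem det_firSymbol_ne_zero {ρ : ℝ} (hρ0 : 0 < ρ) (hρ1 : ρ < 1)
    {Λ : Fin (l + 1) → Matrix (Fin d) (Fin d) ℝ} (hΛ : Λ ∈ multiplierSet d l ρ)
    (hpos : ∀ b, 0 < (1 ᵥ* (∑ i : Fin (l + 1), (ρ⁻¹) ^ (i : ℕ) • Λ i)) b) {s : ℂ} (hs : ‖s‖ ≤ 1) :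
    (firSymbol Λ s).det ≠ 0 := by
  obtain ⟨h0, h1, -, -⟩ := hΛ
  have hs' : ∀ i : ℕ, ‖s ^ i‖ ≤ ρ⁻¹ ^ i := by
    intro i
    rw [norm_pow]
    exact pow_le_pow_left₀ (norm_nonneg _) (hs.trans (one_le_inv₀ hρ0 |>.2 hρ1.le)) i
  have hnp : ∀ (i : Fin (l + 1)) (a b : Fin d), Λ i a b ≤ 0 →
      ‖s ^ (i : ℕ) * (Λ i a b : ℂ)‖ ≤ -(ρ⁻¹ ^ (i : ℕ) * Λ i a b) := by
    intro i a b h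
    rw [norm_mul, Complex.norm_real, Real.norm_of_nonpos h, ← mul_neg]
    exact mul_le_mul_of_nonneg_right (hs' i) (neg_nonneg.2 h)
  have hoff : ∀ a b, a ≠ b → ‖firSymbol Λ s a b‖ ≤ -∑ i : Fin (l + 1), ρ⁻¹ ^ (i : ℕ) * Λ i a b := by
    intro a b hab
    rw [firSymbol_apply, ← Finset.sum_neg_distrib]
    refine norm_sum_le_of_le _ fun i _ => hnp i a b ?_
    by_cases hi : i = 0
    · simpa [hi, Matrix.diagonal_apply_ne _ hab] using h0 a b
    · exact h1 i hi a b
  have hdiag : ∀ b, ∑ i : Fin (l + 1), ρ⁻¹ ^ (i : ℕ) * Λ i b b ≤ ‖firSymbol Λ s b b‖ := by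
    intro b
    rw [firSymbol_apply, Fin.sum_univ_succ, Fin.sum_univ_succ]
    simp only [Fin.val_zero, pow_zero, one_mul]
    have h2 : ‖∑ i : Fin l, s ^ (i.succ : ℕ) * (Λ i.succ b b : ℂ)‖ ≤
        -∑ i : Fin l, ρ⁻¹ ^ (i.succ : ℕ) * Λ i.succ b b := by
      rw [← Finset.sum_neg_distrib]
      exact norm_sum_le_of_le _ fun i _ => hnp i.succ b b (h1 _ (Fin.succ_ne_zero i) b b)
    have h3 := norm_sub_le_norm_add (Λ 0 b b : ℂ)
      (∑ i : Fin l, s ^ (i.succ : ℕ) * (Λ i.succ b b : ℂ))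
    have h4 : Λ 0 b b ≤ ‖(Λ 0 b b : ℂ)‖ := by
      rw [Complex.norm_real]
      exact Real.le_norm_self _
    linarith
  refine det_ne_zero_of_sum_col_lt_diag fun b => ?_
  have hb := hpos b
  simp only [Matrix.vecMul, dotProduct, Pi.one_apply, one_mul, Matrix.sum_apply, Matrix.smul_apply,
    smul_eq_mul] at hb
  rw [← Finset.add_sum_erase _ _ (Finset.mem_univ b)] at hb
  have := Finset.sum_le_sum fun a (ha : a ∈ Finset.univ.erase b) =>
    hoff a b (Finset.ne_of_mem_erase ha)
  rw [Finset.sum_neg_distrib] at this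
  linarith [hdiag b]

/-- A strictly column dominant multiplier defines a filter with a stable right inverse. -/
theorem exists_stable_rightInverse_firFilter {ρ : ℝ} (hρ0 : 0 < ρ) (hρ1 : ρ < 1)
    {Λ : Fin (l + 1) → Matrix (Fin d) (Fin d) ℝ} (hΛ : Λ ∈ multiplierSet d l ρ)
    (hpos : ∀ b, 0 < (1 ᵥ* (∑ i : Fin (l + 1), (ρ⁻¹) ^ (i : ℕ) • Λ i)) b) :
    ∃ R ∈ stableSystems d, (firFilter Λ).op ∘ₗ R = LinearMap.id := by
  have hD : IsUnit (Λ 0).det := by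
    -- The symbol at `0` is the feedthrough matrix `Λ 0`.
    have := det_firSymbol_ne_zero hρ0 hρ1 hΛ hpos (s := 0) (by simp)
    rw [firSymbol_zero, ← RingHom.mapMatrix_apply, ← RingHom.map_det] at this
    exact isUnit_iff_ne_zero.2 fun h => this (by rw [h, map_zero])
  exact ⟨_, StateSpace.op_mem_stableSystems _ (isSchur_inverse_firFilter Λ
    (fun s hs => det_firSymbol_ne_zero hρ0 hρ1 hΛ hpos hs) hD), StateSpace.op_comp_inverse _ hD⟩

/-- Every weighted column sum of the trivial multiplier is `1`, which contributes `t > 0`. -/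
theorem vecMul_sum_pos_of_convexCombination {ρ : ℝ} {Λ : Fin (l + 1) → Matrix (Fin d) (Fin d) ℝ}
    (hΛ : Λ ∈ multiplierSet d l ρ) {a t : ℝ} (ha : 0 ≤ a) (ht : 0 < t) (b : Fin d) :
    0 < (1 ᵥ* (∑ i : Fin (l + 1), (ρ⁻¹) ^ (i : ℕ) •
      (a • Λ + t • trivialMultiplier d l) i)) b := by
  have h1 : ∑ i : Fin (l + 1), (ρ⁻¹) ^ (i : ℕ) • (a • Λ + t • trivialMultiplier d l) i =
      a • (∑ i : Fin (l + 1), (ρ⁻¹) ^ (i : ℕ) • Λ i) + t • 1 := by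
    simp only [Pi.add_apply, Pi.smul_apply, smul_add, Finset.sum_add_distrib, Finset.smul_sum]
    congr 1
    · exact Finset.sum_congr rfl fun i _ => smul_comm _ _ _
    · simp [trivialMultiplier, Fin.sum_univ_succ]
  rw [h1, Matrix.vecMul_add, Matrix.vecMul_smul, Matrix.vecMul_smul, Matrix.vecMul_one]
  have := mul_nonneg ha (hΛ.2.2.2 b)
  simp only [Pi.add_apply, Pi.smul_apply, smul_eq_mul, Pi.one_apply, mul_one]
  linarith

end firFilter

/-! ### Strict negative realness under convex combinations and perturbations. -/

section StrictlyNegativeReal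

variable {d : ℕ}

theorem IsStrictlyNegativeReal.convexCombination {G H : Signal d →ₗ[ℝ] Signal d}
    (hG : IsStrictlyNegativeReal G) (hH : IsStrictlyNegativeReal H) {a b : ℝ} (ha : 0 ≤ a)
    (hb : 0 ≤ b) (hab : a + b = 1) : IsStrictlyNegativeReal (a • G + b • H) := by
  obtain ⟨ε, hε, hG⟩ := hG
  obtain ⟨δ, hδ, hH⟩ := hH
  refine ⟨min ε δ, lt_min hε hδ, fun w => ?_⟩
  obtain ⟨x, hx, hxw⟩ := hG w
  obtain ⟨y, hy, hyw⟩ := hH w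
  refine ⟨a • x + b • y, by
    rw [LinearMap.add_apply, LinearMap.smul_apply, LinearMap.smul_apply, ← hx, ← hy]
    rfl, ?_⟩
  rw [inner_add_left, real_inner_smul_left, real_inner_smul_left]
  have h1 := mul_le_mul_of_nonneg_left
    (hxw.trans (mul_le_mul_of_nonneg_right (neg_le_neg (min_le_left ε δ)) (sq_nonneg ‖w‖))) ha
  have h2 := mul_le_mul_of_nonneg_left
    (hyw.trans (mul_le_mul_of_nonneg_right (neg_le_neg (min_le_right ε δ)) (sq_nonneg ‖w‖))) hb
  have h3 : a * (-min ε δ * ‖w‖ ^ 2) + b * (-min ε δ * ‖w‖ ^ 2) = -min ε δ * ‖w‖ ^ 2 := by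
    rw [← add_mul, hab, one_mul]
  linarith

/-- Strict negative realness is stable under small bounded perturbations. -/
theorem IsStrictlyNegativeReal.exists_perturbation {G H : Signal d →ₗ[ℝ] Signal d}
    (hG : IsStrictlyNegativeReal G) {c : ℝ}
    (hH : ∀ w : L2Signal d, ∃ z : L2Signal d, (z : Signal d) = H w ∧ ‖z‖ ≤ c * ‖w‖) :
    ∃ t : ℝ, 0 < t ∧ t < 1 ∧ IsStrictlyNegativeReal ((1 - t) • G + t • H) := by
  obtain ⟨ε, hε, hG⟩ := hG
  -- The step size `t` solves `(1 - t)ε - t|c| = ε/2`, so half of the margin is kept; `|c|` makes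
  -- the denominator positive for any sign of `c`.
  have hden : 0 < 2 * (ε + |c|) := by positivity
  have ht : 0 < ε / (2 * (ε + |c|)) := by positivity
  have ht1 : ε / (2 * (ε + |c|)) < 1 := by
    rw [div_lt_one hden]
    linarith [abs_nonneg c]
  refine ⟨_, ht, ht1, ε / 2, by positivity, fun w => ?_⟩
  set t := ε / (2 * (ε + |c|)) with htdef
  obtain ⟨x, hx, hxw⟩ := hG w
  obtain ⟨y, hy, hyw⟩ := hH w
  refine ⟨(1 - t) • x + t • y, by
    rw [LinearMap.add_apply, LinearMap.smul_apply, LinearMap.smul_apply, ← hx, ← hy]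
    rfl, ?_⟩
  rw [inner_add_left, real_inner_smul_left, real_inner_smul_left]
  have hyw' : inner ℝ y w ≤ |c| * ‖w‖ ^ 2 := by
    refine (real_inner_le_norm y w).trans ?_
    rw [sq, ← mul_assoc]
    exact mul_le_mul_of_nonneg_right
      (hyw.trans (mul_le_mul_of_nonneg_right (le_abs_self c) (norm_nonneg w))) (norm_nonneg w)
  have h1 := mul_le_mul_of_nonneg_left hxw (sub_nonneg.2 ht1.le)
  have h2 := mul_le_mul_of_nonneg_left hyw' ht.le
  have h3 : t * (ε + |c|) = ε / 2 := by
    rw [htdef]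
    field_simp
  have h4 : (1 - t) * (-ε * ‖w‖ ^ 2) + t * (|c| * ‖w‖ ^ 2) = -(ε / 2) * ‖w‖ ^ 2 := by
    linear_combination ‖w‖ ^ 2 * h3
  linarith

/-- The unit delay on square-summable signals. -/
theorem exists_delay (w : L2Signal d) :
    ∃ z : L2Signal d, z 0 = 0 ∧ (∀ k, z (k + 1) = w k) ∧ ‖z‖ = ‖w‖ := by
  have h2 : 0 < (2 : ENNReal).toReal := by norm_num
  let f : Signal d := fun k => Nat.casesOn k 0 w
  have hsum := lp.hasSum_norm h2 w
  have hf : HasSum (fun k => ‖f k‖ ^ (2 : ENNReal).toReal) (‖w‖ ^ (2 : ENNReal).toReal) := by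
    rw [← hasSum_nat_add_iff' 1]
    simpa [f] using hsum
  refine ⟨⟨f, memℓp_gen hf.summable⟩, rfl, fun _ => rfl, ?_⟩
  have := (lp.hasSum_norm h2 (⟨f, memℓp_gen hf.summable⟩ : L2Signal d)).unique hf
  exact (Real.rpow_left_inj (norm_nonneg _) (norm_nonneg _) h2.ne').1 this

end StrictlyNegativeReal

/-! ### The systems `T₁` and `T₂`. -/

section Youla

variable {d : ℕ} (m L ρ : ℝ)

theorem op_youlaT2 : (youlaT2 d m L).op = (L - m) • LinearMap.id := by
  ext w k : 2
  simp only [StateSpace.op_apply, youlaT2, Matrix.zero_mulVec, zero_add,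
    Matrix.smul_mulVec, Matrix.one_mulVec, ← sub_smul, WithLp.toLp_smul, WithLp.toLp_ofLp,
    LinearMap.smul_apply, LinearMap.id_apply, Pi.smul_apply]

theorem op_youlaT1_zero (w : Signal d) : (youlaT1 d m L ρ).op w 0 = -w 0 := by
  simp [StateSpace.op_apply, youlaT1, StateSpace.state, Matrix.neg_mulVec]

theorem op_youlaT1_succ (w : Signal d) (k : ℕ) :
    (youlaT1 d m L ρ).op w (k + 1) = (-((L * m⁻¹ - 1) * ρ⁻¹)) • w k - w (k + 1) := by
  simp [StateSpace.op_apply, youlaT1, StateSpace.state, Matrix.neg_mulVec, Matrix.smul_mulVec,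
    smul_smul, sub_eq_add_neg]

/-- `T₁` is minus the identity minus `σρ⁻¹` times the unit delay, and the delay is an isometry. -/
theorem op_youlaT1_bounded (w : L2Signal d) :
    ∃ z : L2Signal d, (z : Signal d) = (youlaT1 d m L ρ).op w ∧
      ‖z‖ ≤ (|(L * m⁻¹ - 1) * ρ⁻¹| + 1) * ‖w‖ := by
  obtain ⟨x, hx0, hx, hxw⟩ := exists_delay w
  refine ⟨(-((L * m⁻¹ - 1) * ρ⁻¹)) • x - w, ?_, ?_⟩
  · funext k
    change (-((L * m⁻¹ - 1) * ρ⁻¹)) • x k - w k = _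
    cases k with
    | zero => rw [op_youlaT1_zero, hx0, smul_zero, zero_sub]
    | succ k => rw [op_youlaT1_succ, hx]
  · refine (norm_sub_le _ _).trans ?_
    rw [norm_smul, hxw, norm_neg, Real.norm_eq_abs, add_mul, one_mul]

end Youla

/-! ### The main theorem. -/

theorem mainTheorem4 (d l : ℕ) (m L ρ : ℝ) (hm : 0 < m) (hmL : m < L) (hρ0 : 0 < ρ) (hρ1 : ρ < 1)
    (S : Set (Fin (l + 1) → Matrix (Fin d) (Fin d) ℝ))
    (hSρ : S ⊆ multiplierSet d l ρ) (hS : Convex ℝ S) (hS1 : trivialMultiplier d l ∈ S) :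
    -- the two search problems are equivalent
    ((∃ Λ ∈ S, ∃ Q ∈ stableSystems d,
        IsStrictlyNegativeReal ((firFilter Λ).op ∘ₗ
          ((youlaT1 d m L ρ).op + (youlaT2 d m L).op ∘ₗ Q ∘ₗ (youlaT3 d ρ).op))) ↔
      ∃ Λ ∈ S, ∃ Z ∈ stableSystems d,
        IsStrictlyNegativeReal ((firFilter Λ).op ∘ₗ (youlaT1 d m L ρ).op +
          Z ∘ₗ (youlaT3 d ρ).op)) ∧
    -- the change of variables `Z = Π(Λ) T₂ Q` carries the first problem into the second one
    (∀ Λ ∈ S, ∀ Q ∈ stableSystems d, ∀ Z : Signal d →ₗ[ℝ] Signal d,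
      Z = (firFilter Λ).op ∘ₗ (youlaT2 d m L).op ∘ₗ Q →
        Z ∈ stableSystems d ∧
        (firFilter Λ).op ∘ₗ
            ((youlaT1 d m L ρ).op + (youlaT2 d m L).op ∘ₗ Q ∘ₗ (youlaT3 d ρ).op) =
          (firFilter Λ).op ∘ₗ (youlaT1 d m L ρ).op + Z ∘ₗ (youlaT3 d ρ).op) ∧
    -- the joint search over `Λ` and `Z` in the second problem is convex
    Convex ℝ {p : (Fin (l + 1) → Matrix (Fin d) (Fin d) ℝ) × (Signal d →ₗ[ℝ] Signal d) |
      p.1 ∈ S ∧ p.2 ∈ stableSystems d ∧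
        IsStrictlyNegativeReal ((firFilter p.1).op ∘ₗ (youlaT1 d m L ρ).op +
          p.2 ∘ₗ (youlaT3 d ρ).op)} := by
  have hchange : ∀ Λ ∈ S, ∀ Q ∈ stableSystems d, ∀ Z : Signal d →ₗ[ℝ] Signal d,
      Z = (firFilter Λ).op ∘ₗ (youlaT2 d m L).op ∘ₗ Q →
        Z ∈ stableSystems d ∧
        (firFilter Λ).op ∘ₗ
            ((youlaT1 d m L ρ).op + (youlaT2 d m L).op ∘ₗ Q ∘ₗ (youlaT3 d ρ).op) =
          (firFilter Λ).op ∘ₗ (youlaT1 d m L ρ).op + Z ∘ₗ (youlaT3 d ρ).op := by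
    rintro Λ - Q hQ _ rfl
    refine ⟨comp_mem_stableSystems
      (StateSpace.op_mem_stableSystems _ (isSchur_firFilter Λ)) ?_, ?_⟩
    · rw [op_youlaT2, LinearMap.smul_comp, LinearMap.id_comp]
      exact smul_mem_stableSystems _ hQ
    · simp only [LinearMap.comp_add, LinearMap.comp_assoc]
  refine ⟨⟨?_, ?_⟩, hchange, ?_⟩
  · rintro ⟨Λ, hΛ, Q, hQ, h⟩
    obtain ⟨hZ, heq⟩ := hchange Λ hΛ Q hQ _ rfl
    exact ⟨Λ, hΛ, _, hZ, heq ▸ h⟩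
  · rintro ⟨Λ, hΛ, Z, hZ, h⟩
    obtain ⟨t, ht0, ht1, hsnr⟩ := h.exists_perturbation (op_youlaT1_bounded m L ρ)
    have ht1' : 0 ≤ 1 - t := sub_nonneg.2 ht1.le
    have hmem : (1 - t) • Λ + t • trivialMultiplier d l ∈ S :=
      hS hΛ hS1 ht1' ht0.le (sub_add_cancel 1 t)
    obtain ⟨R, hR, hRinv⟩ := exists_stable_rightInverse_firFilter hρ0 hρ1 (hSρ hmem)
      (vecMul_sum_pos_of_convexCombination (hSρ hΛ) ht1' ht0)
    -- This `Q` solves `Π T₂ Q = (1 - t)Z` for the perturbed filter `Π`: `R` is its stable right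
    -- inverse and `(L - m)⁻¹` undoes `T₂`.
    have hQ := smul_mem_stableSystems ((L - m)⁻¹ * (1 - t)) (comp_mem_stableSystems hR hZ)
    refine ⟨_, hmem, _, hQ, ?_⟩
    rw [(hchange _ hmem _ hQ _ rfl).2]
    have hZ' : (firFilter ((1 - t) • Λ + t • trivialMultiplier d l)).op ∘ₗ (youlaT2 d m L).op ∘ₗ
        (((L - m)⁻¹ * (1 - t)) • (R ∘ₗ Z)) = (1 - t) • Z := by
      rw [op_youlaT2, LinearMap.smul_comp, LinearMap.id_comp, smul_smul, ← mul_assoc,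
        mul_inv_cancel₀ (sub_pos.2 hmL).ne', one_mul, LinearMap.comp_smul, ← LinearMap.comp_assoc,
        hRinv, LinearMap.id_comp]
    rw [hZ', op_firFilter_add, op_firFilter_smul, op_firFilter_smul,
      op_firFilter_trivialMultiplier]
    -- By linearity in the multiplier, both operators equal `(1 - t)(Π(Λ)T₁ + ZT₃) + tT₁`.
    convert hsnr using 1
    simp only [LinearMap.add_comp, LinearMap.smul_comp, LinearMap.id_comp, smul_add]
    abel
  · rintro ⟨Λ, Z⟩ ⟨hΛ, hZ, h⟩ ⟨Λ', Z'⟩ ⟨hΛ', hZ', h'⟩ a b ha hb hab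
    refine ⟨hS hΛ hΛ' ha hb hab, convex_stableSystems hZ hZ' ha hb hab, ?_⟩
    convert h.convexCombination h' ha hb hab using 1
    simp only [Prod.smul_mk, Prod.mk_add_mk, op_firFilter_add, op_firFilter_smul,
      LinearMap.add_comp, LinearMap.smul_comp, smul_add]
    abel
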